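/- Let $N\ge 2$, let $|1\rangle,\dots,|N\rangle$ be the standard basis of $\mathbb{C}^N$, and let $\Omega_N$ be the set of states, i.e. of positive semidefinite complex $N\times N$ matrices of trace one. Let $\Omega_0\subset\Omega_N$ be the face consisting of the states whose support (range) is orthogonal to $\sum_{i=1}^N|i\rangle$. The diagonal map (pinching channel) is $\Phi_D(\omega)=\sum_{i=1}^N P_i\,\omega\,P_i$ with $P_i=|i\rangle\langle i|$. The output entropy of a state $\omega$ is $S^D_{\mathrm{out}}(\omega)=S(\Phi_D(\omega))$, where $S(\rho)=-\operatorname{Tr}\rho\log\rho$ is the von Neumann entropy (natural logarithm, $0\log 0=0$). Put $S^D_{\min}(\Omega_0)=\min_{\omega\in\Omega_0}S^D_{\mathrm{out}}(\omega)$; this minimum is attained. - For $N=2,3,\dots,6$ we have $S^D_{\min}(\Omega_0)=\log 2$. The states in $\Omega_0$ (pure or mixed) that attain the minimum are exactly the $N(N-1)/2$ pure states $\pi_{jk}=|\phi_{jk}\rangle\langle\phi_{jk}|$, $j<k$, where $|\phi_{jk}\rangle=2^{-1/2}(|j\rangle-|k\rangle)$. - For $N>6$ we have $$S^D_{\min}(\Omega_0)=\log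 N-\Bigl(1-\frac2N\Bigr)\log(N-1),$$ and the minimum is attained by the $N$ distinct pure states $\pi_j=|\phi_j\rangle\langle\phi_j|$, $j=1,\dots,N$, where $\phi_j\in\mathbb{C}^N$ has $j$-th component $(N-1)a$ and all other components $-a$, with $a=(N(N-1))^{-1/2}$. - $\lim_{N\to\infty}S^D_{\min}(\Omega_0)=0$. -/

import Mathlib

namespace DiagonalMap

open scoped ComplexOrder

/-- The basis vector `|i⟩` of the `N`-dimensional Hilbert space `ℂ^N`. -/
noncomputable def ket {N : ℕ} (i : Fin N) : EuclideanSpace ℂ (Fin N) :=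
  EuclideanSpace.single i 1

/-- The operator `|ψ⟩⟨ψ|`; it is the pure state of `ψ` when `ψ` is a unit vector. -/
def pureState {N : ℕ} (ψ : EuclideanSpace ℂ (Fin N)) : Matrix (Fin N) (Fin N) ℂ :=
  Matrix.vecMulVec (fun i => ψ i) (star fun i => ψ i)

/-- The state space `Ω_N`: positive semidefinite matrices of trace one. -/
def stateSpace (N : ℕ) : Set (Matrix (Fin N) (Fin N) ℂ) :=
  {ω | ω.PosSemidef ∧ ω.trace = 1}

/-- The support of a Hermitian operator, i.e. its range. -/
noncomputable def support {N : ℕ} (ω : Matrix (Fin N) (Fin N) ℂ) :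
    Submodule ℂ (EuclideanSpace ℂ (Fin N)) :=
  LinearMap.range (Matrix.toEuclideanLin ω)

/-- The face `Ω₀` of `Ω_N`: states whose support is orthogonal to `∑ i, |i⟩`. -/
def face (N : ℕ) : Set (Matrix (Fin N) (Fin N) ℂ) :=
  {ω | ω ∈ stateSpace N ∧ support ω ⟂ Submodule.span ℂ {∑ i : Fin N, ket i}}

/-- The diagonal map (pinching) in Kraus form, with `P_i = |i⟩⟨i|`. -/
noncomputable def diagonalMap {N : ℕ} (ω : Matrix (Fin N) (Fin N) ℂ) :
    Matrix (Fin N) (Fin N) ℂ :=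
  ∑ i : Fin N, pureState (ket i) * ω * pureState (ket i)

/-- The von Neumann entropy `S(ρ) = Tr η(ρ)`, where `η(x) = -x log x` and `η(0) = 0`, through the
continuous functional calculus of Hermitian matrices. -/
noncomputable def entropy {N : ℕ} (ρ : Matrix (Fin N) (Fin N) ℂ) : ℝ :=
  (cfc Real.negMulLog ρ).trace.re

/-- The output entropy of the diagonal map. -/
noncomputable def outputEntropy {N : ℕ} (ω : Matrix (Fin N) (Fin N) ℂ) : ℝ :=
  entropy (diagonalMap ω)

/-- The minimal output entropy of the diagonal map on the face `Ω₀`. -/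
noncomputable def minOutputEntropy (N : ℕ) : ℝ :=
  sInf (outputEntropy '' face N)

/-- The states in `Ω₀` that attain the minimal output entropy. -/
def minimizers (N : ℕ) : Set (Matrix (Fin N) (Fin N) ℂ) :=
  {ω | ω ∈ face N ∧ IsMinOn outputEntropy (face N) ω}

/-- The vector `(|j⟩ - |k⟩) / √2`. -/
noncomputable def phiPair {N : ℕ} (j k : Fin N) : EuclideanSpace ℂ (Fin N) :=
  (((√2)⁻¹ : ℝ) : ℂ) • (ket j - ket k)

/-- The states `π_{jk}`, `j < k`. -/
def pairStates (N : ℕ) : Set (Matrix (Fin N) (Fin N) ℂ) :=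
  {ω | ∃ j k : Fin N, j < k ∧ ω = pureState (phiPair j k)}

/-- The number `a = (N (N - 1))^{-1/2}`. -/
noncomputable def amplitude (N : ℕ) : ℝ := (√((N : ℝ) * ((N : ℝ) - 1)))⁻¹

/-- The vector with component `(N - 1) a` at position `j` and all other components `-a`. -/
noncomputable def phiSingle {N : ℕ} (j : Fin N) : EuclideanSpace ℂ (Fin N) :=
  WithLp.toLp 2 fun i =>
    (((if i = j then ((N : ℝ) - 1) * amplitude N else -amplitude N) : ℝ) : ℂ)

/-- The states `π_j`. -/
def singleStates (N : ℕ) : Set (Matrix (Fin N) (Fin N) ℂ) :=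
  {ω | ∃ j : Fin N, ω = pureState (phiSingle j)}

end DiagonalMap

open Finset

/-! The pinching keeps only the diagonal `p` of `ω`, so the output entropy is the Shannon entropy of
`p`. Writing a state of the face as a Gram matrix of vectors `v i`, one gets `∑ v i = 0` and `‖v i‖
= √(p i)`, so the `√(p i)` obey the polygon inequality (`diag_of_mem_face`). It remains to minimise
the Shannon entropy under that constraint.

If all `p i ≤ 1/2`, then `-p log p ≥ p log 2` termwise, so the entropy is at least `log 2`, with
equality only when every entry is `0` or `1/2`. Otherwise some `p j > 1/2`. With the sum and the sum
of squares of the other `√(p i)` fixed, their contribution is least when they are proportional to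
`(k, 1, …, 1)`, because `t² log t` lies on `[0, k]` below a quadratic that agrees with it at `1` and
`k` (`sum_sq_mul_log_le`). Raising `p j` until the polygon degenerates lowers the bound further and
leaves the curve `extremalEntropy m k` with `m = N - 2`, `k ≥ 1` (`exists_extremalEntropy_le`).

This curve starts at `k = 1` with the entropy of `π_j` and tends to `log 2` as `k → ∞`. A
second-derivative argument shows that it does not fall below the smaller of these two values; which
one is smaller changes between `N = 6` and `N = 7`. -/

/-! ### Maximising `∑ t² log t` with two moments fixed -/

theorem two_mul_log_le_sub_inv {x : ℝ} (hx : 1 ≤ x) : 2 * Real.log x ≤ x - x⁻¹ := by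
  have h := Real.self_le_sinh_iff.2 (Real.log_nonneg hx)
  rw [Real.sinh_log (by linarith)] at h
  linarith

theorem one_sub_le_mul_log {x : ℝ} (hx : 0 ≤ x) : x - 1 ≤ x * Real.log x := by
  rcases hx.eq_or_lt with rfl | hx
  · simp
  · have h := Real.one_sub_inv_le_log_of_pos hx
    have h2 := mul_le_mul_of_nonneg_left h hx.le
    rwa [mul_sub, mul_one, mul_inv_cancel₀ hx.ne'] at h2

/-- The function vanishes at `1`, so `2x(x log x - x + 1)` is at most `(1 - x)²` to the left of `1`
and at least that to the right. -/
theorem antitoneOn_quadratic_sub_log :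
    AntitoneOn (fun x : ℝ => (1 - x) ^ 2 - 2 * x * (x * Real.log x - x + 1)) (Set.Ici 0) := by
  have key : ∀ x : ℝ, 0 < x →
      HasDerivAt (fun x : ℝ => (1 - x) ^ 2 - 2 * x * (x * Real.log x - x + 1))
        (-4 * (x * Real.log x - (x - 1))) x := by
    intro x hx
    have h1 := ((hasDerivAt_id x).const_sub 1).pow 2
    have h2 := (Real.hasDerivAt_mul_log hx.ne').sub (hasDerivAt_id x) |>.add_const 1
    have h3 := h1.sub (((hasDerivAt_id x).const_mul 2).mul h2)
    refine h3.congr_deriv ?_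
    simp
    ring
  apply antitoneOn_of_deriv_nonpos (convex_Ici 0)
  · exact (((continuous_const.sub continuous_id).pow 2).sub ((continuous_const.mul
      continuous_id).mul ((Real.continuous_mul_log.sub continuous_id).add
      continuous_const))).continuousOn
  · rw [interior_Ici]
    exact fun x hx => (key x hx).differentiableAt.differentiableWithinAt
  · rw [interior_Ici]
    intro x hx
    rw [(key x hx).deriv]
    have := one_sub_le_mul_log (le_of_lt (Set.mem_Ioi.1 hx))
    linarith

theorem monotoneOn_log_quotient :
    MonotoneOn (fun x : ℝ => 2 * x * (x * Real.log x - x + 1) / (x - 1) ^ 2) (Set.Ioi 1) := by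
  have key : ∀ x : ℝ, 1 < x → HasDerivAt
      (fun x : ℝ => 2 * x * (x * Real.log x - x + 1) / (x - 1) ^ 2)
      (2 * x * ((x - x⁻¹) - 2 * Real.log x) / (x - 1) ^ 3) x := by
    intro x hx
    have hx0 : x ≠ 0 := by linarith
    have hx1 : x - 1 ≠ 0 := by linarith
    have h1 := ((hasDerivAt_id x).sub_const 1).pow 2
    have h2 := (Real.hasDerivAt_mul_log hx0).sub (hasDerivAt_id x) |>.add_const 1
    have h3 := ((((hasDerivAt_id x).const_mul 2).mul h2)).div h1 (by simpa using hx1)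
    refine h3.congr_deriv ?_
    simp
    field_simp
    ring
  apply monotoneOn_of_deriv_nonneg (convex_Ioi 1)
  · exact fun x hx => (key x hx).continuousAt.continuousWithinAt
  · rw [interior_Ioi]
    exact fun x hx => (key x hx).differentiableAt.differentiableWithinAt
  · rw [interior_Ioi]
    intro x hx
    have hx1 : (1 : ℝ) < x := hx
    rw [(key x hx).deriv]
    have := two_mul_log_le_sub_inv hx1.le
    have h1 : 0 < x - 1 := by linarith
    have h2 : 0 ≤ (x - x⁻¹) - 2 * Real.log x := by linarith
    positivity

/-- The constant is the ratio of the two sides at `k`. On `(1, k]` the ratio is increasing; on `[0,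
1]` it is at most `1 ≤ c`. For `k = 1` the ratio is `0/0`, and its limit `1` is used. -/
theorem exists_quadratic_majorant {k : ℝ} (hk : 1 ≤ k) :
    ∃ c : ℝ, c * (1 - k) ^ 2 = 2 * k * (k * Real.log k - k + 1) ∧
      ∀ x, 0 ≤ x → x ≤ k → 2 * x * (x * Real.log x - x + 1) ≤ c * (1 - x) ^ 2 := by
  have hanti := antitoneOn_quadratic_sub_log
  have hle : ∀ x : ℝ, 0 ≤ x → x ≤ 1 →
      2 * x * (x * Real.log x - x + 1) ≤ (1 - x) ^ 2 := by
    intro x h0 h1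
    have := hanti (Set.mem_Ici.2 h0) (Set.mem_Ici.2 zero_le_one) h1
    simp at this
    linarith
  rcases hk.eq_or_lt with rfl | hk
  · exact ⟨1, by simp, fun x h0 h1 => by simpa using hle x h0 h1⟩
  have hk1 : 0 < (k - 1) ^ 2 := by have : 0 < k - 1 := by linarith
                                   positivity
  have hc : 2 * k * (k * Real.log k - k + 1) / (k - 1) ^ 2 * (1 - k) ^ 2 =
      2 * k * (k * Real.log k - k + 1) := by
    rw [show (1 - k) ^ 2 = (k - 1) ^ 2 by ring]
    field_simp
  refine ⟨_, hc, fun x h0 hxk => ?_⟩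
  rcases le_or_gt x 1 with h1 | h1
  · refine (hle x h0 h1).trans ?_
    have := hanti (Set.mem_Ici.2 zero_le_one) (Set.mem_Ici.2 (by linarith)) hk.le
    simp at this
    have hc1 : 1 ≤ 2 * k * (k * Real.log k - k + 1) / (k - 1) ^ 2 := by
      rw [le_div_iff₀ hk1]
      nlinarith
    nlinarith [sq_nonneg (1 - x)]
  · have := monotoneOn_log_quotient (Set.mem_Ioi.2 h1) (Set.mem_Ioi.2 hk) hxk
    have hx1 : 0 < (x - 1) ^ 2 := by have : 0 < x - 1 := by linarith
                                     positivity
    simp only at this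
    rw [div_le_iff₀ hx1] at this
    rwa [show (1 - x) ^ 2 = (x - 1) ^ 2 by ring]

/-- By Cauchy–Schwarz on the other `m` entries, an excess `e > 0` over `k` would force `(m - e)² ≤
m(m - 2ke - e²)`, which is impossible. This places all entries where the majorant is valid. -/
theorem le_of_sum_eq_of_sum_sq_eq {ι : Type*} {s : Finset ι} {t : ι → ℝ} {k : ℝ} {m : ℕ}
    (hk : 1 ≤ k) (hcard : #s = m + 1) (h1 : ∑ i ∈ s, t i = k + m)
    (h2 : ∑ i ∈ s, t i ^ 2 = k ^ 2 + m) {j : ι} (hj : j ∈ s) : t j ≤ k := by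
  classical
  by_contra! hlt
  have hcs := sq_sum_le_card_mul_sum_sq (s := s.erase j) (f := t)
  rw [card_erase_of_mem hj, hcard, sum_erase_eq_sub hj, sum_erase_eq_sub hj, h1, h2] at hcs
  simp only [add_tsub_cancel_right] at hcs
  obtain ⟨e, hje⟩ : ∃ e, t j = k + e := ⟨t j - k, by ring⟩
  rw [hje] at hcs hlt
  have he : 0 < e := by linarith
  have hm : (0 : ℝ) ≤ m := m.cast_nonneg
  nlinarith [mul_nonneg (mul_nonneg hm he.le) (sub_nonneg.2 hk), mul_nonneg hm (sq_nonneg e),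
    sq_pos_of_pos he]

/-- The sum of a quadratic depends only on the two moments, which are those of `(k, 1, …, 1)`, and
there the majorant is exact. -/
theorem sum_sq_mul_log_le {ι : Type*} {s : Finset ι} {t : ι → ℝ} {k : ℝ} {m : ℕ}
    (hk : 1 ≤ k) (ht : ∀ i ∈ s, 0 ≤ t i) (hcard : #s = m + 1) (h1 : ∑ i ∈ s, t i = k + m)
    (h2 : ∑ i ∈ s, t i ^ 2 = k ^ 2 + m) :
    ∑ i ∈ s, t i ^ 2 * Real.log (t i) ≤ k ^ 2 * Real.log k := by
  obtain ⟨c, hc, hle⟩ := exists_quadratic_majorant hk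
  have hterm : ∀ i ∈ s, 2 * (t i ^ 2 * Real.log (t i)) ≤
      (2 + c) * t i ^ 2 - (2 + 2 * c) * t i + c := by
    intro i hi
    have := hle (t i) (ht i hi) (le_of_sum_eq_of_sum_sq_eq hk hcard h1 h2 hi)
    nlinarith
  have hsum := sum_le_sum hterm
  rw [← mul_sum, sum_add_distrib, sum_sub_distrib, ← mul_sum, ← mul_sum, h1, h2, sum_const,
    hcard, nsmul_eq_mul] at hsum
  push_cast at hsum
  nlinarith

/-! ### Reduction to a one-parameter family -/

/-- Fits `d · (k, 1, …, 1)` to a prescribed sum and sum of squares. With `R = s / σ²`, `k` is the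
larger root of `k² + m = R (k + m)²`; Cauchy–Schwarz gives `R (m + 1) ≥ 1`, hence a nonnegative
discriminant and `k ≥ 1`. -/
theorem exists_extremal_parameters {m : ℕ} (hm : 0 < m) {σ s : ℝ} (hσ : 0 < σ) (hs : s < σ ^ 2)
    (hcs : σ ^ 2 ≤ (m + 1) * s) :
    ∃ k d : ℝ, 1 ≤ k ∧ 0 < d ∧ σ = d * (k + m) ∧ s = d ^ 2 * (k ^ 2 + m) := by
  have hm' : (0 : ℝ) < m := by exact_mod_cast hm
  set R := s / σ ^ 2 with hR
  have hσ2 : 0 < σ ^ 2 := by positivity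
  have hR1 : R < 1 := by rw [hR, div_lt_one hσ2]; exact hs
  have hRm : 1 ≤ R * (m + 1) := by
    rw [hR, div_mul_eq_mul_div, le_div_iff₀ hσ2]; linarith
  have hdisc : 0 ≤ m * (R * (m + 1) - 1) := by
    have : 0 ≤ R * (m + 1) - 1 := by linarith
    positivity
  obtain ⟨q, hq0, hq⟩ : ∃ q : ℝ, 0 ≤ q ∧ q ^ 2 = m * (R * (m + 1) - 1) :=
    ⟨_, Real.sqrt_nonneg _, Real.sq_sqrt hdisc⟩
  have h1R : 0 < 1 - R := by linarith
  obtain ⟨k, hk⟩ : ∃ k, k * (1 - R) = R * m + q := ⟨(R * m + q) / (1 - R), by field_simp⟩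
  have hk1 : 1 ≤ k := by
    by_contra! h
    nlinarith
  have hkm : 0 < k + m := by linarith
  have hquad : k ^ 2 + m = R * (k + m) ^ 2 := by
    have : (1 - R) * (k ^ 2 + m - R * (k + m) ^ 2) = 0 := by
      have e : (k * (1 - R) - R * m) ^ 2 = q ^ 2 := by rw [hk]; ring
      rw [hq] at e
      linear_combination e
    rcases mul_eq_zero.1 this with h | h <;> linarith
  refine ⟨k, σ / (k + m), hk1, by positivity, by field_simp, ?_⟩
  rw [hquad, hR]
  field_simp

/-- The entropy of the distribution proportional to `((k + m) ^ 2, k ^ 2, 1, …, 1)`, with `m` ones. -/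
noncomputable def extremalEntropy (m k : ℝ) : ℝ :=
  (((k + m) ^ 2 + (k ^ 2 + m)) * Real.log ((k + m) ^ 2 + (k ^ 2 + m)) -
    2 * (k + m) ^ 2 * Real.log (k + m) - 2 * k ^ 2 * Real.log k) / ((k + m) ^ 2 + (k ^ 2 + m))

theorem negMulLog_sq (x : ℝ) : Real.negMulLog (x ^ 2) = -(2 * (x ^ 2 * Real.log x)) := by
  rw [Real.negMulLog, Real.log_pow]
  push_cast
  ring

/-- Chain rule for entropy: split off the first outcome, then add the entropy of the rest weighted
by its probability. -/
theorem extremalEntropy_eq_binEntropy_add {m k : ℝ} (hm : 0 ≤ m) (hk : 1 ≤ k) :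
    extremalEntropy m k =
      Real.binEntropy ((k + m) ^ 2 / ((k + m) ^ 2 + (k ^ 2 + m))) +
        (1 - (k + m) ^ 2 / ((k + m) ^ 2 + (k ^ 2 + m))) *
          (Real.log (k ^ 2 + m) - 2 * k ^ 2 * Real.log k / (k ^ 2 + m)) := by
  have hA : 0 < k + m := by linarith
  have hB : 0 < k ^ 2 + m := by positivity
  have h1 : 1 - (k + m) ^ 2 / ((k + m) ^ 2 + (k ^ 2 + m)) =
      (k ^ 2 + m) / ((k + m) ^ 2 + (k ^ 2 + m)) := by
    field_simp
    ring
  rw [Real.binEntropy_eq_negMulLog_add_negMulLog_one_sub, h1, extremalEntropy, Real.negMulLog,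
    Real.negMulLog, Real.log_div (by positivity) (by positivity),
    Real.log_div (by positivity) (by positivity), Real.log_pow]
  field_simp
  push_cast
  ring

theorem exists_extremalEntropy_le {ι : Type*} [Fintype ι] [DecidableEq ι] {p : ι → ℝ} {j : ι}
    (hp : ∀ i, 0 ≤ p i) (hsum : ∑ i, p i = 1) (hj : 1 / 2 < p j)
    (hpoly : √(p j) ≤ ∑ i ∈ univ.erase j, √(p i)) :
    ∃ (m : ℕ) (k : ℝ), 0 < m ∧ Fintype.card ι = m + 2 ∧ 1 ≤ k ∧
      extremalEntropy m k ≤ ∑ i, Real.negMulLog (p i) := by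
  set σ := ∑ i ∈ univ.erase j, √(p i) with hσ_def
  have hσ : 0 < σ := (Real.sqrt_pos.2 (by linarith)).trans_le hpoly
  have hpσ : p j ≤ σ ^ 2 := by
    rw [← Real.sq_sqrt (hp j)]
    exact pow_le_pow_left₀ (Real.sqrt_nonneg _) hpoly 2
  have hs : ∑ i ∈ univ.erase j, √(p i) ^ 2 = 1 - p j := by
    rw [← hsum, ← sum_erase_eq_sub (mem_univ j)]
    exact sum_congr rfl fun i _ => Real.sq_sqrt (hp i)
  have hcs := sq_sum_le_card_mul_sum_sq (s := univ.erase j) (f := fun i => √(p i))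
  rw [hs, ← hσ_def] at hcs
  have hcard := card_erase_of_mem (mem_univ j)
  rw [card_univ] at hcard
  -- A single other entry would give `p j ≤ σ² ≤ 1 - p j < 1/2`, so `N = 2` never reaches this case.
  have hcard2 : 2 ≤ #(univ.erase j) := by
    by_contra! h
    have : (#(univ.erase j) : ℝ) ≤ 1 := by exact_mod_cast Nat.lt_succ_iff.1 h
    nlinarith [hp j]
  obtain ⟨m, hm⟩ : ∃ m, #(univ.erase j) = m + 1 := ⟨#(univ.erase j) - 1, by omega⟩
  have hm0 : 0 < m := by omega
  have hmR : (0 : ℝ) < m := by exact_mod_cast hm0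
  rw [hm] at hcs
  push_cast at hcs
  obtain ⟨k, d, hk, hd, hkσ, hks⟩ :=
    exists_extremal_parameters hm0 hσ (s := 1 - p j) (by linarith) hcs
  refine ⟨m, k, hm0, by omega, hk, ?_⟩
  have hA : 0 < k + m := by linarith
  have hB : 0 < k ^ 2 + m := by positivity
  have hlog := sum_sq_mul_log_le (s := univ.erase j) (t := fun i => √(p i) / d) hk
    (fun i _ => by positivity) hm
    (by rw [← sum_div, ← hσ_def, hkσ]; field_simp)
    (by simp_rw [div_pow]; rw [← sum_div, hs, hks]; field_simp)
  have hterm : ∀ i ∈ univ.erase j, Real.negMulLog (p i) =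
      (√(p i) / d) ^ 2 * Real.negMulLog (d ^ 2) -
        2 * d ^ 2 * ((√(p i) / d) ^ 2 * Real.log (√(p i) / d)) := by
    intro i _
    have e : p i = d ^ 2 * (√(p i) / d) ^ 2 := by
      rw [div_pow, Real.sq_sqrt (hp i)]; field_simp
    conv_lhs => rw [e]
    rw [Real.negMulLog_mul, negMulLog_sq (√(p i) / d)]
    ring
  have htail : (k ^ 2 + m) * Real.negMulLog (d ^ 2) - 2 * d ^ 2 * (k ^ 2 * Real.log k) ≤
      ∑ i ∈ univ.erase j, Real.negMulLog (p i) := by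
    rw [sum_congr rfl hterm, sum_sub_distrib, ← sum_mul, ← mul_sum]
    have : ∑ i ∈ univ.erase j, (√(p i) / d) ^ 2 = k ^ 2 + m := by
      simp_rw [div_pow]; rw [← sum_div, hs, hks]; field_simp
    rw [this]
    gcongr
  have htail_eq : (k ^ 2 + m) * Real.negMulLog (d ^ 2) - 2 * d ^ 2 * (k ^ 2 * Real.log k) =
      Real.negMulLog (1 - p j) + (1 - p j) *
        (Real.log (k ^ 2 + m) - 2 * k ^ 2 * Real.log k / (k ^ 2 + m)) := by
    rw [hks, Real.negMulLog_mul (d ^ 2), Real.negMulLog, Real.negMulLog]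
    field_simp
    ring
  -- This is the entropy of the normalised tail `(k², 1, …, 1)`; its sign makes `(1 - p) * E`
  -- decrease in `p`.
  have hE : 0 ≤ Real.log (k ^ 2 + m) - 2 * k ^ 2 * Real.log k / (k ^ 2 + m) := by
    have h1 : Real.log (k ^ 2) ≤ Real.log (k ^ 2 + m) :=
      Real.log_le_log (by positivity) (by linarith)
    rw [Real.log_pow] at h1
    push_cast at h1
    have h2 : 2 * k ^ 2 * Real.log k / (k ^ 2 + m) ≤ 2 * Real.log k := by
      rw [div_le_iff₀ hB]
      nlinarith [Real.log_nonneg hk]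
    linarith
  -- The right side is the weight of the largest outcome when the polygon inequality is an equality.
  have hP : p j ≤ (k + m) ^ 2 / ((k + m) ^ 2 + (k ^ 2 + m)) := by
    rw [le_div_iff₀ (by positivity)]
    have h1 : 0 ≤ 1 - p j := by rw [hks]; positivity
    have h2 := mul_le_mul_of_nonneg_right hpσ h1
    have e : p j * (1 - p j) = p j * (d ^ 2 * (k ^ 2 + m)) := by rw [← hks]
    rw [hkσ, e] at h2
    have h3 : d ^ 2 * (p j * (k ^ 2 + m)) ≤ d ^ 2 * ((k + m) ^ 2 * (1 - p j)) := by
      linarith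
    have h4 := le_of_mul_le_mul_left h3 (by positivity)
    linarith
  have hP1 : (k + m) ^ 2 / ((k + m) ^ 2 + (k ^ 2 + m)) ≤ 1 := by
    rw [div_le_one (by positivity)]
    linarith
  have hbin := Real.binEntropy_strictAntiOn.antitoneOn (a := p j)
    ⟨by norm_num; linarith, hP.trans hP1⟩ ⟨by norm_num; linarith, hP1⟩ hP
  rw [Real.binEntropy_eq_negMulLog_add_negMulLog_one_sub (p j)] at hbin
  rw [extremalEntropy_eq_binEntropy_add hmR.le hk, ← add_sum_erase _ _ (mem_univ j)]
  have := mul_le_mul_of_nonneg_right (sub_le_sub_left hP 1) hE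
  linarith

/-! ### Monotonicity along the extremal family -/

/-- The function `k ↦ Q * (extremalEntropy m k - v)`, where `Q` is the denominator. -/
noncomputable def entropyExcess (m v k : ℝ) : ℝ :=
  ((k + m) ^ 2 + (k ^ 2 + m)) * (Real.log ((k + m) ^ 2 + (k ^ 2 + m)) - v) -
    2 * (k + m) ^ 2 * Real.log (k + m) - 2 * k ^ 2 * Real.log k

noncomputable def entropyExcessDeriv (m v k : ℝ) : ℝ :=
  (4 * k + 2 * m) * (Real.log ((k + m) ^ 2 + (k ^ 2 + m)) - v) -
    4 * ((k + m) * Real.log (k + m)) - 4 * (k * Real.log k)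

/-- A quarter of the second derivative of `entropyExcess`, in the variable
`w = Q / (k * (k + m))`. -/
noncomputable def excessCurvature (c v w : ℝ) : ℝ := Real.log w - v - c * (1 - 2 / w)

theorem entropyExcess_eq {m v k : ℝ} (hm : 0 ≤ m) (hk : 1 ≤ k) :
    entropyExcess m v k = ((k + m) ^ 2 + (k ^ 2 + m)) * (extremalEntropy m k - v) := by
  have : 0 < (k + m) ^ 2 + (k ^ 2 + m) := by positivity
  rw [entropyExcess, extremalEntropy]
  field_simp
  ring

theorem hasDerivAt_denominator (m k : ℝ) :
    HasDerivAt (fun k : ℝ => (k + m) ^ 2 + (k ^ 2 + m)) (4 * k + 2 * m) k := by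
  have h := (((hasDerivAt_id k).add_const m).pow 2).add (((hasDerivAt_id k).pow 2).add_const m)
  refine h.congr_deriv ?_
  simp
  ring

theorem hasDerivAt_entropyExcess {m k : ℝ} (v : ℝ) (hm : 0 ≤ m) (hk : 0 < k) :
    HasDerivAt (entropyExcess m v) (entropyExcessDeriv m v k) k := by
  have hA : 0 < k + m := by linarith
  have hQ : 0 < (k + m) ^ 2 + (k ^ 2 + m) := by positivity
  have h1 := hasDerivAt_denominator m k
  have h2 := h1.mul ((h1.log hQ.ne').sub_const v)
  have hA' := (hasDerivAt_id k).add_const m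
  have h3 := ((hA'.pow 2).const_mul 2).mul (hA'.log hA.ne')
  have h4 := (((hasDerivAt_id k).pow 2).const_mul 2).mul ((hasDerivAt_id k).log hk.ne')
  refine ((h2.sub h3).sub h4).congr_deriv ?_
  simp [entropyExcessDeriv]
  field_simp
  ring

theorem hasDerivAt_entropyExcessDeriv {m k : ℝ} (v : ℝ) (hm : 0 ≤ m) (hk : 0 < k) :
    HasDerivAt (entropyExcessDeriv m v)
      (4 * excessCurvature ((m + 2) / (m + 1)) v (2 + m * (m + 1) / (k * (k + m)))) k := by
  have hA : 0 < k + m := by linarith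
  have hQ : 0 < (k + m) ^ 2 + (k ^ 2 + m) := by positivity
  have h1 := hasDerivAt_denominator m k
  have h0 := ((hasDerivAt_id k).const_mul 4).add_const (2 * m)
  have h2 := h0.mul ((h1.log hQ.ne').sub_const v)
  have hA' := (hasDerivAt_id k).add_const m
  have h3 := (hA'.mul (hA'.log hA.ne')).const_mul 4
  have h4 := (((hasDerivAt_id k)).mul ((hasDerivAt_id k).log hk.ne')).const_mul 4
  refine ((h2.sub h3).sub h4).congr_deriv ?_
  have hw : 2 + m * (m + 1) / (k * (k + m)) = ((k + m) ^ 2 + (k ^ 2 + m)) / (k * (k + m)) := by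
    field_simp
    ring
  rw [excessCurvature, hw, Real.log_div hQ.ne' (by positivity), Real.log_mul hk.ne' hA.ne']
  simp
  field_simp
  ring

/-- The output entropy of the states `singleStates N`. -/
noncomputable def singleEntropy (N : ℝ) : ℝ := Real.log N - (1 - 2 / N) * Real.log (N - 1)

theorem extremalEntropy_one {m : ℝ} (hm : 0 ≤ m) :
    extremalEntropy m 1 = singleEntropy (m + 2) := by
  have h : (1 + m) ^ 2 + (1 ^ 2 + m) = (m + 1) * (m + 2) := by ring
  rw [extremalEntropy, singleEntropy, h, Real.log_mul (by positivity) (by positivity),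
    Real.log_one, show m + 2 - 1 = m + 1 by ring, add_comm 1 m]
  field_simp
  ring

theorem entropyExcess_one {m : ℝ} (v : ℝ) (hm : 0 ≤ m) :
    entropyExcess m v 1 = (m + 1) * (m + 2) * (singleEntropy (m + 2) - v) := by
  rw [entropyExcess_eq hm le_rfl, extremalEntropy_one hm]
  ring

theorem entropyExcessDeriv_one {m : ℝ} (v : ℝ) (hm : 0 ≤ m) :
    entropyExcessDeriv m v 1 = 2 * (m + 2) * (singleEntropy (m + 2) - v) := by
  have h : (1 + m) ^ 2 + (1 ^ 2 + m) = (m + 1) * (m + 2) := by ring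
  rw [entropyExcessDeriv, singleEntropy, h, Real.log_mul (by positivity) (by positivity),
    Real.log_one, show m + 2 - 1 = m + 1 by ring, add_comm 1 m]
  field_simp
  ring

theorem monotoneOn_entropyExcess {m v : ℝ} (hm : 0 ≤ m)
    (h : ∀ k, 1 ≤ k → 0 ≤ entropyExcessDeriv m v k) :
    MonotoneOn (entropyExcess m v) (Set.Ici 1) := by
  have hd : ∀ k ∈ Set.Ici (1 : ℝ), HasDerivAt (entropyExcess m v) (entropyExcessDeriv m v k) k :=
    fun k hk => hasDerivAt_entropyExcess v hm (zero_lt_one.trans_le hk)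
  apply monotoneOn_of_deriv_nonneg (convex_Ici 1)
  · exact fun k hk => (hd k hk).continuousAt.continuousWithinAt
  · exact fun k hk => (hd k (interior_subset hk)).differentiableAt.differentiableWithinAt
  · intro k hk
    rw [(hd k (interior_subset hk)).deriv]
    exact h k (interior_subset hk)

theorem entropyExcessDeriv_le_of_curvature_nonneg {m v a b : ℝ} (hm : 0 ≤ m) (ha : 0 < a)
    (hab : a ≤ b) (h : ∀ k ∈ Set.Icc a b,
      0 ≤ excessCurvature ((m + 2) / (m + 1)) v (2 + m * (m + 1) / (k * (k + m)))) :
    entropyExcessDeriv m v a ≤ entropyExcessDeriv m v b := by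
  have hd : ∀ k ∈ Set.Icc a b, HasDerivAt (entropyExcessDeriv m v) _ k :=
    fun k hk => hasDerivAt_entropyExcessDeriv v hm (ha.trans_le hk.1)
  refine monotoneOn_of_deriv_nonneg (convex_Icc a b) ?_ ?_ ?_ (Set.left_mem_Icc.2 hab)
    (Set.right_mem_Icc.2 hab) hab
  · exact fun k hk => (hd k hk).continuousAt.continuousWithinAt
  · exact fun k hk => (hd k (interior_subset hk)).differentiableAt.differentiableWithinAt
  · intro k hk
    rw [(hd k (interior_subset hk)).deriv]
    have := h k (interior_subset hk)
    positivity

theorem le_entropyExcessDeriv_of_curvature_nonpos {m v a b : ℝ} (hm : 0 ≤ m) (ha : 0 < a)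
    (hab : a ≤ b) (h : ∀ k ∈ Set.Icc a b,
      excessCurvature ((m + 2) / (m + 1)) v (2 + m * (m + 1) / (k * (k + m))) ≤ 0) :
    entropyExcessDeriv m v b ≤ entropyExcessDeriv m v a := by
  have hd : ∀ k ∈ Set.Icc a b, HasDerivAt (entropyExcessDeriv m v) _ k :=
    fun k hk => hasDerivAt_entropyExcessDeriv v hm (ha.trans_le hk.1)
  refine antitoneOn_of_deriv_nonpos (convex_Icc a b) ?_ ?_ ?_ (Set.left_mem_Icc.2 hab)
    (Set.right_mem_Icc.2 hab) hab
  · exact fun k hk => (hd k hk).continuousAt.continuousWithinAt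
  · exact fun k hk => (hd k (interior_subset hk)).differentiableAt.differentiableWithinAt
  · intro k hk
    rw [(hd k (interior_subset hk)).deriv]
    have := h k (interior_subset hk)
    linarith

/-- The bound is the value at the minimum `w = 2 * c`. -/
theorem le_excessCurvature {c v w : ℝ} (hc : 0 < c) (hw : 0 < w) :
    Real.log (2 * c) + 1 - c - v ≤ excessCurvature c v w := by
  have h := Real.log_le_sub_one_of_pos (show 0 < 2 * c / w by positivity)
  rw [Real.log_div (by positivity) hw.ne'] at h
  have e : c * (1 - 2 / w) = c - 2 * c / w := by ring
  rw [excessCurvature, e]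
  linarith

theorem hasDerivAt_excessCurvature {c v w : ℝ} (hw : 0 < w) :
    HasDerivAt (excessCurvature c v) ((w - 2 * c) / w ^ 2) w := by
  have h := ((Real.hasDerivAt_log hw.ne').sub_const v).sub
    ((((hasDerivAt_inv hw.ne').const_mul 2).const_sub 1).const_mul c)
  have e : excessCurvature c v = fun w => Real.log w - v - c * (1 - 2 * w⁻¹) := by
    ext w
    rw [excessCurvature, div_eq_mul_inv]
  rw [e]
  refine h.congr_deriv ?_
  field_simp

theorem excessCurvature_monotoneOn {c v : ℝ} (hc : 0 < c) :
    MonotoneOn (excessCurvature c v) (Set.Ici (2 * c)) := by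
  have hd : ∀ w ∈ Set.Ici (2 * c), HasDerivAt (excessCurvature c v) ((w - 2 * c) / w ^ 2) w :=
    fun w hw => hasDerivAt_excessCurvature (lt_of_lt_of_le (by positivity) hw)
  apply monotoneOn_of_deriv_nonneg (convex_Ici _)
  · exact fun w hw => (hd w hw).continuousAt.continuousWithinAt
  · exact fun w hw => (hd w (interior_subset hw)).differentiableAt.differentiableWithinAt
  · intro w hw
    rw [(hd w (interior_subset hw)).deriv]
    have : 2 * c ≤ w := interior_subset hw
    exact div_nonneg (by linarith) (sq_nonneg w)

theorem excessCurvature_antitoneOn {c v : ℝ} :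
    AntitoneOn (excessCurvature c v) (Set.Ioc 0 (2 * c)) := by
  have hd : ∀ w ∈ Set.Ioc 0 (2 * c), HasDerivAt (excessCurvature c v) ((w - 2 * c) / w ^ 2) w :=
    fun w hw => hasDerivAt_excessCurvature hw.1
  apply antitoneOn_of_deriv_nonpos (convex_Ioc _ _)
  · exact fun w hw => (hd w hw).continuousAt.continuousWithinAt
  · exact fun w hw => (hd w (interior_subset hw)).differentiableAt.differentiableWithinAt
  · intro w hw
    rw [(hd w (interior_subset hw)).deriv]
    have : w ≤ 2 * c := (interior_subset hw).2
    exact div_nonpos_of_nonpos_of_nonneg (by linarith) (sq_nonneg w)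

theorem excessCurvature_two (c : ℝ) : excessCurvature c (Real.log 2) 2 = 0 := by
  simp [excessCurvature]

/-- Once the curvature is positive, it stays nonnegative. -/
theorem excessCurvature_nonneg_of_pos {c w w' : ℝ} (hc : 0 < c) (hw : 2 ≤ w)
    (h : 0 < excessCurvature c (Real.log 2) w) (hw' : w ≤ w') :
    0 ≤ excessCurvature c (Real.log 2) w' := by
  rcases le_total (2 * c) w with h1 | h1
  · exact h.le.trans (excessCurvature_monotoneOn hc h1 (h1.trans hw') hw')
  · have := excessCurvature_antitoneOn (v := Real.log 2) (c := c)
      ⟨two_pos, hw.trans h1⟩ ⟨by linarith, h1⟩ hw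
    rw [excessCurvature_two] at this
    linarith

/-- Supplies the behaviour at infinity: the derivative has no negative limit as `k → ∞`. -/
theorem neg_le_entropyExcessDeriv_log_two {m k : ℝ} (hm : 0 ≤ m) (hk : 0 < k) :
    -(2 * m ^ 2 / k) ≤ entropyExcessDeriv m (Real.log 2) k := by
  have hA : 0 < k + m := by linarith
  have h1 : Real.log k + Real.log (k + m) ≤
      Real.log ((k + m) ^ 2 + (k ^ 2 + m)) - Real.log 2 := by
    rw [← Real.log_mul hk.ne' hA.ne', ← Real.log_div (by positivity) two_ne_zero]
    apply Real.log_le_log (by positivity)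
    nlinarith [sq_nonneg m]
  have h2 : Real.log (k + m) - Real.log k ≤ m / k := by
    rw [← Real.log_div hA.ne' hk.ne']
    refine (Real.log_le_sub_one_of_pos (by positivity)).trans_eq ?_
    field_simp
    ring
  have h3 := mul_le_mul_of_nonneg_left h1 (show 0 ≤ 4 * k + 2 * m by positivity)
  have h4 := mul_le_mul_of_nonneg_left h2 (show 0 ≤ 2 * m by positivity)
  have e : 2 * m * (m / k) = 2 * m ^ 2 / k := by ring
  rw [e] at h4
  rw [entropyExcessDeriv]
  linarith

/-- As `k` grows, `w` decreases towards `2`, where the curvature vanishes. As a function of `w ≥ 2`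
the curvature first falls and then rises, so in `k` no positive value follows a nonpositive one.
Where it is positive, the derivative is at least its nonnegative value at `1`; afterwards it
decreases, but stays above a bound tending to `0`. -/
theorem entropyExcessDeriv_log_two_nonneg {m k : ℝ} (hm : 0 ≤ m)
    (hs : Real.log 2 ≤ singleEntropy (m + 2)) (hk : 1 ≤ k) :
    0 ≤ entropyExcessDeriv m (Real.log 2) k := by
  have hk0 : 0 < k := by linarith
  have hc : 0 < (m + 2) / (m + 1) := by positivity
  have hw2 : ∀ x : ℝ, 0 < x → 2 ≤ 2 + m * (m + 1) / (x * (x + m)) := fun x hx => by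
    have : 0 ≤ m * (m + 1) / (x * (x + m)) := by positivity
    linarith
  have hw : ∀ x y : ℝ, 0 < x → x ≤ y →
      2 + m * (m + 1) / (y * (y + m)) ≤ 2 + m * (m + 1) / (x * (x + m)) := by
    intro x y hx hxy
    have : 0 < y := by linarith
    gcongr
  by_cases hpos :
      0 < excessCurvature ((m + 2) / (m + 1)) (Real.log 2) (2 + m * (m + 1) / (k * (k + m)))
  · have h1 := entropyExcessDeriv_le_of_curvature_nonneg (v := Real.log 2) hm one_pos hk
      fun x hx => excessCurvature_nonneg_of_pos hc (hw2 k hk0) hpos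
        (hw x k (by linarith [hx.1]) hx.2)
    rw [entropyExcessDeriv_one _ hm] at h1
    refine le_trans ?_ h1
    have : 0 ≤ singleEntropy (m + 2) - Real.log 2 := by linarith
    positivity
  · have h1 : ∀ K, k ≤ K → -(2 * m ^ 2 / K) ≤ entropyExcessDeriv m (Real.log 2) k := by
      intro K hK
      refine (neg_le_entropyExcessDeriv_log_two hm (by linarith)).trans
        (le_entropyExcessDeriv_of_curvature_nonpos hm hk0 hK fun x hx => ?_)
      by_contra! hx'
      have hx0 : 0 < x := by linarith [hx.1]
      have hlt : 0 < excessCurvature ((m + 2) / (m + 1)) (Real.log 2)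
          (2 + m * (m + 1) / (k * (k + m))) := by
        rcases le_total (2 * ((m + 2) / (m + 1))) (2 + m * (m + 1) / (x * (x + m))) with h2 | h2
        · exact hx'.trans_le
            (excessCurvature_monotoneOn hc h2 (h2.trans (hw k x hk0 hx.1)) (hw k x hk0 hx.1))
        · have := excessCurvature_antitoneOn (v := Real.log 2)
            ⟨two_pos, (hw2 x hx0).trans h2⟩ ⟨by linarith [hw2 x hx0], h2⟩ (hw2 x hx0)
          rw [excessCurvature_two] at this
          linarith
      exact hpos hlt
    have hlim : Filter.Tendsto (fun K : ℝ => -(2 * m ^ 2 / K)) Filter.atTop (nhds 0) := by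
      simpa using (tendsto_const_nhds.div_atTop Filter.tendsto_id :
        Filter.Tendsto (fun K : ℝ => 2 * m ^ 2 / K) Filter.atTop (nhds 0)).neg
    exact le_of_tendsto hlim (Filter.eventually_atTop.2 ⟨k, h1⟩)

theorem lt_extremalEntropy_of_lt {m k : ℝ} (hm : 0 ≤ m)
    (hs : Real.log 2 < singleEntropy (m + 2)) (hk : 1 ≤ k) :
    Real.log 2 < extremalEntropy m k := by
  have h := monotoneOn_entropyExcess hm
    (fun k hk => entropyExcessDeriv_log_two_nonneg hm hs.le hk) (Set.mem_Ici.2 le_rfl)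
    (Set.mem_Ici.2 hk) hk
  rw [entropyExcess_one _ hm, entropyExcess_eq hm hk] at h
  have h1 : 0 < (m + 1) * (m + 2) * (singleEntropy (m + 2) - Real.log 2) :=
    mul_pos (by positivity) (by linarith)
  have h2 := pos_of_mul_pos_right (h1.trans_le h) (by positivity)
  linarith

/-- With `v` the value at `k = 1`, both the excess and its derivative vanish there, so nonnegative
curvature suffices. The gap below `log 2` is `x²/2` with `x = 1 / (m + 1)`, which pays for `log (1 +
x) ≥ x - x²/2` at the minimum of the curvature. -/
theorem singleEntropy_le_extremalEntropy {m k : ℝ} (hm : 0 ≤ m)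
    (hs : singleEntropy (m + 2) ≤ Real.log 2 - 1 / (2 * (m + 1) ^ 2)) (hk : 1 ≤ k) :
    singleEntropy (m + 2) ≤ extremalEntropy m k := by
  have hcurv : ∀ k : ℝ, 0 < k → 0 ≤ excessCurvature ((m + 2) / (m + 1)) (singleEntropy (m + 2))
      (2 + m * (m + 1) / (k * (k + m))) := by
    intro k hk
    refine le_trans ?_ (le_excessCurvature (by positivity) (by positivity))
    have e : (m + 2) / (m + 1) = 1 + 1 / (m + 1) := by field_simp; ring
    have hx : 0 < 1 / (m + 1) := by positivity
    rw [Real.log_mul two_ne_zero (by positivity), e]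
    have h1 := Real.le_log_one_add_of_nonneg hx.le
    have h2 : 1 / (m + 1) - 1 / (2 * (m + 1) ^ 2) ≤ 2 * (1 / (m + 1)) / (1 / (m + 1) + 2) := by
      have e2 : 1 / (2 * (m + 1) ^ 2) = (1 / (m + 1)) ^ 2 / 2 := by field_simp
      rw [e2, le_div_iff₀ (by positivity)]
      nlinarith [pow_pos hx 3]
    linarith
  have hderiv : ∀ k : ℝ, 1 ≤ k → 0 ≤ entropyExcessDeriv m (singleEntropy (m + 2)) k := by
    intro k hk
    have := entropyExcessDeriv_le_of_curvature_nonneg (v := singleEntropy (m + 2)) hm one_pos hk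
      fun x hx => hcurv x (by linarith [hx.1])
    rwa [entropyExcessDeriv_one _ hm, sub_self, mul_zero] at this
  have h := monotoneOn_entropyExcess hm hderiv (Set.mem_Ici.2 le_rfl) (Set.mem_Ici.2 hk) hk
  rw [entropyExcess_one _ hm, entropyExcess_eq hm hk, sub_self, mul_zero] at h
  have h2 := nonneg_of_mul_nonneg_right h (by positivity)
  linarith

/-! ### Comparing the entropy of `π_j` with `log 2` -/

theorem singleEntropy_le_singleEntropy_seven {N : ℝ} (hN : 7 ≤ N) :
    singleEntropy N ≤ singleEntropy 7 := by
  have hN0 : 0 < N := by linarith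
  -- The tangent bound `log (N - 1) ≤ log 6 + (N - 7) / 6` reduces the comparison of the second
  -- terms to `7/6 ≤ log 6`.
  have hlog6 : 7 / 6 ≤ Real.log 6 := by
    have h2 := Real.log_two_gt_d9
    have h3 : Real.log 2 ≤ Real.log 3 := Real.log_le_log (by norm_num) (by norm_num)
    rw [show (6 : ℝ) = 2 * 3 by norm_num, Real.log_mul (by norm_num) (by norm_num)]
    linarith
  have h1 : Real.log N - Real.log (N - 1) ≤ Real.log 7 - Real.log 6 := by
    rw [← Real.log_div hN0.ne' (by linarith), ← Real.log_div (by norm_num) (by norm_num)]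
    apply Real.log_le_log (div_pos hN0 (by linarith))
    rw [div_le_div_iff₀ (by linarith) (by norm_num)]
    linarith
  have h2 : 2 / N * Real.log (N - 1) ≤ 2 / 7 * Real.log 6 := by
    have h3 := Real.log_le_sub_one_of_pos (show 0 < (N - 1) / 6 by linarith)
    rw [Real.log_div (by linarith) (by norm_num)] at h3
    rw [div_mul_eq_mul_div, div_le_iff₀ hN0]
    nlinarith
  rw [singleEntropy, singleEntropy, show (7 : ℝ) - 1 = 6 by norm_num]
  linarith

/-- Here `1/72 = 1 / (2 · 6²)` is the gap that `singleEntropy_le_extremalEntropy` needs at `m + 1 =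
6`. -/
theorem singleEntropy_seven_le : singleEntropy 7 ≤ Real.log 2 - 1 / 72 := by
  have h : Real.log (2 ^ 7 * 6 ^ 5 / 7 ^ 7) = 7 * Real.log 2 + 5 * Real.log 6 - 7 * Real.log 7 := by
    rw [Real.log_div (by norm_num) (by norm_num), Real.log_mul (by norm_num) (by norm_num),
      Real.log_pow, Real.log_pow, Real.log_pow]
    norm_num
  have h2 := Real.one_sub_inv_le_log_of_pos (show (0 : ℝ) < 2 ^ 7 * 6 ^ 5 / 7 ^ 7 by norm_num)
  rw [h] at h2
  norm_num at h2
  rw [singleEntropy, show (7 : ℝ) - 1 = 6 by norm_num]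
  linarith

theorem singleEntropy_le_of_seven_le {N : ℝ} (hN : 7 ≤ N) :
    singleEntropy N ≤ Real.log 2 - 1 / 72 :=
  (singleEntropy_le_singleEntropy_seven hN).trans singleEntropy_seven_le

/-- Exponentiated, the claim is the integer inequality `2^N (N-1)^(N-2) < N^N`, which fails at `N =
2` (equality) and at `N = 7`. -/
theorem log_two_lt_singleEntropy {N : ℕ} (h3 : 3 ≤ N) (h6 : N ≤ 6) :
    Real.log 2 < singleEntropy N := by
  have key : ∀ {a b c : ℕ}, 0 < b → 2 ^ c * b ^ (c - 2) < a ^ c → 2 ≤ c →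
      Real.log 2 < Real.log a - (1 - 2 / c) * Real.log b := by
    intro a b c hb h hc
    have hb' : (0 : ℝ) < b := by exact_mod_cast hb
    have hc' : (0 : ℝ) < c := by exact_mod_cast (by omega : 0 < c)
    have h' : (2 : ℝ) ^ c * (b : ℝ) ^ (c - 2) < (a : ℝ) ^ c := by exact_mod_cast h
    have hl := Real.log_lt_log (by positivity) h'
    rw [Real.log_mul (by positivity) (by positivity), Real.log_pow, Real.log_pow, Real.log_pow,
      Nat.cast_sub hc] at hl
    have : c * Real.log 2 < c * (Real.log a - (1 - 2 / c) * Real.log b) := by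
      have e : c * (Real.log a - (1 - 2 / c) * Real.log b) =
        c * Real.log a - (c - 2) * Real.log b := by field_simp
      rw [e]
      push_cast at hl
      linarith
    exact lt_of_mul_lt_mul_left this hc'.le
  have := key (a := N) (b := N - 1) (c := N) (by omega) (by interval_cases N <;> norm_num)
    (by omega)
  rwa [Nat.cast_sub (by omega), Nat.cast_one] at this

theorem tendsto_singleEntropy :
    Filter.Tendsto (fun N : ℕ => singleEntropy N) Filter.atTop (nhds 0) := by
  -- The majorant comes from the form `log (N / (N - 1)) + (2 / N) log (N - 1)`.
  have h1 : Filter.Tendsto (fun x : ℝ => 1 / (x - 1) + 2 * (Real.log x / x)) Filter.atTop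
      (nhds (0 + 2 * 0)) := by
    refine Filter.Tendsto.add ?_ (Filter.Tendsto.const_mul 2 ?_)
    · exact tendsto_const_nhds.div_atTop
        (Filter.tendsto_atTop_add_const_right _ (-1) Filter.tendsto_id)
    · simpa using Real.isLittleO_log_id_atTop.tendsto_div_nhds_zero
  rw [mul_zero, add_zero] at h1
  refine squeeze_zero' ?_ ?_ (h1.comp tendsto_natCast_atTop_atTop)
  all_goals
    filter_upwards [Filter.eventually_ge_atTop 2] with N hN
    have hN2 : (2 : ℝ) ≤ N := by exact_mod_cast hN
    have hN0 : (0 : ℝ) < N := by linarith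
    have hN1 : (0 : ℝ) < N - 1 := by linarith
    have hle : Real.log (N - 1) ≤ Real.log N := Real.log_le_log hN1 (by linarith)
    have h0 : 0 ≤ Real.log ((N : ℝ) - 1) := Real.log_nonneg (by linarith)
    have h2 : 0 ≤ 2 / (N : ℝ) := by positivity
    have h3 := mul_nonneg h2 h0
    have h4 := mul_le_mul_of_nonneg_left hle h2
  · rw [singleEntropy]
    linarith
  · have h5 := Real.log_le_sub_one_of_pos (div_pos hN0 hN1)
    rw [Real.log_div hN0.ne' hN1.ne'] at h5
    have e : (N : ℝ) / (N - 1) - 1 = 1 / (N - 1) := by field_simp; ring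
    simp only [Function.comp, singleEntropy]
    have e2 : 2 * (Real.log N / N) = 2 / N * Real.log N := by ring
    rw [e2]
    linarith

/-! ### Entropy bounds under the polygon inequality -/

theorem log_two_le_sum_negMulLog {ι : Type*} [Fintype ι] {p : ι → ℝ} (hp : ∀ i, 0 ≤ p i)
    (hsum : ∑ i, p i = 1) (hle : ∀ i, p i ≤ 1 / 2) :
    Real.log 2 ≤ ∑ i, Real.negMulLog (p i) ∧
      (∑ i, Real.negMulLog (p i) = Real.log 2 → ∀ i, p i = 0 ∨ p i = 1 / 2) := by
  have hterm : ∀ i, p i * Real.log 2 ≤ Real.negMulLog (p i) ∧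
      (Real.negMulLog (p i) = p i * Real.log 2 → p i = 0 ∨ p i = 1 / 2) := by
    intro i
    rcases (hp i).eq_or_lt with h | h
    · simp [← h]
    · have e : p i * Real.log 2 = -(p i * Real.log (1 / 2)) := by simp
      rw [Real.negMulLog, e, neg_mul]
      refine ⟨neg_le_neg (mul_le_mul_of_nonneg_left (Real.log_le_log h (hle i)) h.le), ?_⟩
      intro h2
      right
      exact Real.log_injOn_pos h (by norm_num : (0 : ℝ) < 1 / 2)
        (mul_left_cancel₀ h.ne' (neg_injective h2))
  have hs : ∑ i, p i * Real.log 2 = Real.log 2 := by rw [← sum_mul, hsum, one_mul]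
  constructor
  · rw [← hs]
    exact sum_le_sum fun i _ => (hterm i).1
  · intro h i
    rw [← hs] at h
    exact (hterm i).2 ((sum_eq_sum_iff_of_le fun i _ => (hterm i).1).1 h.symm i (mem_univ i)).symm

/-- The polygon inequality for the side lengths `√(p i)`. -/
def IsPolygon {ι : Type*} [Fintype ι] [DecidableEq ι] (p : ι → ℝ) : Prop :=
  ∀ j, √(p j) ≤ ∑ i ∈ univ.erase j, √(p i)

theorem log_two_le_entropy_of_isPolygon {ι : Type*} [Fintype ι] [DecidableEq ι] {p : ι → ℝ}
    (hp : ∀ i, 0 ≤ p i) (hsum : ∑ i, p i = 1) (hpoly : IsPolygon p)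
    (hcard : Fintype.card ι ≤ 6) :
    Real.log 2 ≤ ∑ i, Real.negMulLog (p i) ∧
      (∑ i, Real.negMulLog (p i) = Real.log 2 → ∀ i, p i = 0 ∨ p i = 1 / 2) := by
  by_cases h : ∀ i, p i ≤ 1 / 2
  · exact log_two_le_sum_negMulLog hp hsum h
  · push Not at h
    obtain ⟨j, hj⟩ := h
    obtain ⟨m, k, hm, hN, hk, hle⟩ := exists_extremalEntropy_le hp hsum hj (hpoly j)
    have hs := log_two_lt_singleEntropy (N := m + 2) (by omega) (by omega)
    push_cast at hs
    have := (lt_extremalEntropy_of_lt m.cast_nonneg hs hk).trans_le hle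
    exact ⟨this.le, fun h => absurd h this.ne'⟩

theorem singleEntropy_le_entropy_of_isPolygon {ι : Type*} [Fintype ι] [DecidableEq ι]
    {p : ι → ℝ} (hp : ∀ i, 0 ≤ p i) (hsum : ∑ i, p i = 1) (hpoly : IsPolygon p)
    (hcard : 7 ≤ Fintype.card ι) :
    singleEntropy (Fintype.card ι) ≤ ∑ i, Real.negMulLog (p i) := by
  have h7 : (7 : ℝ) ≤ Fintype.card ι := by exact_mod_cast hcard
  have hV := singleEntropy_le_of_seven_le h7
  by_cases h : ∀ i, p i ≤ 1 / 2
  · linarith [(log_two_le_sum_negMulLog hp hsum h).1]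
  · push Not at h
    obtain ⟨j, hj⟩ := h
    obtain ⟨m, k, hm, hN, hk, hle⟩ := exists_extremalEntropy_le hp hsum hj (hpoly j)
    rw [hN] at hV h7 ⊢
    push_cast at hV h7 ⊢
    refine le_trans (singleEntropy_le_extremalEntropy m.cast_nonneg ?_ hk) hle
    have : 1 / (2 * ((m : ℝ) + 1) ^ 2) ≤ 1 / 72 := by
      apply one_div_le_one_div_of_le (by norm_num)
      nlinarith
    linarith

/-! ### From states in the face to their diagonals -/

namespace DiagonalMap

open scoped ComplexOrder

theorem pureState_ket {N : ℕ} (i : Fin N) : pureState (ket i) = Matrix.single i i 1 := by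
  ext a b
  simp only [pureState, ket, Matrix.vecMulVec_apply, Matrix.single_apply, Pi.star_apply,
    PiLp.single_apply, eq_comm (a := i)]
  by_cases ha : a = i <;> by_cases hb : b = i <;> simp [ha, hb]

theorem diagonalMap_eq_diagonal {N : ℕ} (ω : Matrix (Fin N) (Fin N) ℂ) :
    diagonalMap ω = Matrix.diagonal fun i => ω i i := by
  simp only [diagonalMap, pureState_ket, Matrix.single_mul_mul_single, one_mul, mul_one]
  ext a b
  rw [Matrix.sum_apply, Matrix.diagonal_apply]
  simp only [Matrix.single_apply]
  split_ifs with h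
  · subst h
    simp
  · refine sum_eq_zero fun c _ => ?_
    rw [if_neg]
    rintro ⟨rfl, rfl⟩
    exact h rfl

/-- The functional calculus is computed from the eigenvalues; the characteristic polynomial
identifies their multiset with that of the diagonal entries. -/
theorem entropy_diagonal {N : ℕ} (r : Fin N → ℝ) :
    entropy (Matrix.diagonal fun i => (r i : ℂ)) = ∑ i, Real.negMulLog (r i) := by
  have hA : (Matrix.diagonal fun i => (r i : ℂ)).IsHermitian :=
    Matrix.isHermitian_diagonal_of_self_adjoint _ (by ext; simp)
  have hroots : ∀ f : Fin N → ℂ,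
      (∏ i, (Polynomial.X - Polynomial.C (f i))).roots = univ.val.map f := by
    intro f
    rw [Polynomial.roots_prod _ _ (Finset.prod_ne_zero_iff.2 fun i _ =>
      Polynomial.X_sub_C_ne_zero _)]
    simp
  have h1 : univ.val.map (fun i => (hA.eigenvalues i : ℂ)) = univ.val.map fun i => (r i : ℂ) := by
    rw [← hroots, ← hroots, ← Matrix.charpoly_diagonal fun i => (r i : ℂ)]
    exact congrArg _ hA.charpoly_eq.symm
  have h2 : univ.val.map hA.eigenvalues = univ.val.map r := by
    have := congrArg (Multiset.map Complex.re) h1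
    simpa [Multiset.map_map, Function.comp_def] using this
  have h3 : (cfc Real.negMulLog (Matrix.diagonal fun i => (r i : ℂ))).trace =
      ((∑ i, Real.negMulLog (hA.eigenvalues i) : ℝ) : ℂ) := by
    rw [Matrix.trace_eq_sum_roots_charpoly, hA.charpoly_cfc_eq]
    erw [hroots]
    push_cast
    rfl
  rw [entropy, h3, Complex.ofReal_re]
  have := congrArg (fun s => (s.map Real.negMulLog).sum) h2
  simp only [Multiset.map_map, Function.comp_def] at this
  exact this

theorem outputEntropy_eq {N : ℕ} {ω : Matrix (Fin N) (Fin N) ℂ} (hω : ω.IsHermitian) :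
    outputEntropy ω = ∑ i, Real.negMulLog (ω i i).re := by
  rw [outputEntropy, diagonalMap_eq_diagonal, ← entropy_diagonal]
  congr 2
  ext i
  exact (Complex.conj_eq_iff_re.1 (hω.apply i i)).symm

theorem mem_face_iff {N : ℕ} {ω : Matrix (Fin N) (Fin N) ℂ} :
    ω ∈ face N ↔ ω ∈ stateSpace N ∧ ∀ j, ∑ i, ω i j = 0 := by
  have hinner : ∀ x : EuclideanSpace ℂ (Fin N),
      inner ℂ x (∑ i, ket i) = star (∑ i, x i) := by
    intro x
    rw [inner_sum, star_sum]
    refine sum_congr rfl fun i _ => ?_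
    simp [ket, EuclideanSpace.inner_single_right]
  refine and_congr_right fun _ => ?_
  rw [Submodule.isOrtho_iff_inner_eq]
  constructor
  · intro h j
    have := h _ (LinearMap.mem_range_self (Matrix.toEuclideanLin ω) (ket j)) _
      (Submodule.mem_span_singleton_self _)
    rw [hinner, star_eq_zero] at this
    simpa [ket] using this
  · rintro h _ ⟨x, rfl⟩ v hv
    obtain ⟨c, rfl⟩ := Submodule.mem_span_singleton.1 hv
    rw [inner_smul_right, hinner]
    have : ∑ i, Matrix.toEuclideanLin ω x i = 0 := by
      simp only [Matrix.toLpLin_apply, Matrix.mulVec, dotProduct]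
      rw [sum_comm]
      simp [← sum_mul, h]
    rw [this, star_zero, mul_zero]

/-- The vectors are the columns of `B` in `ω = B* B`; the squared norm of their sum is the sum of
all entries of `ω`, which is zero. -/
theorem exists_gram_of_mem_face {N : ℕ} {ω : Matrix (Fin N) (Fin N) ℂ} (h : ω ∈ face N) :
    ∃ v : Fin N → EuclideanSpace ℂ (Fin N), (∀ i j, ω i j = inner ℂ (v i) (v j)) ∧
      ∑ i, v i = 0 := by
  obtain ⟨⟨hpos, -⟩, hsum⟩ := mem_face_iff.1 h
  obtain ⟨B, hB⟩ : ∃ B, ω = star B * B := by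
    open scoped MatrixOrder in
    exact CStarAlgebra.nonneg_iff_eq_star_mul_self.1 hpos.nonneg
  have hin : ∀ i j, ω i j =
      inner ℂ (WithLp.toLp 2 (B.col i) : EuclideanSpace ℂ (Fin N)) (WithLp.toLp 2 (B.col j)) := by
    intro i j
    rw [hB, EuclideanSpace.inner_eq_star_dotProduct, Matrix.mul_apply, dotProduct]
    refine sum_congr rfl fun a _ => ?_
    simp [Matrix.star_apply, mul_comm]
  refine ⟨fun i => WithLp.toLp 2 (B.col i), hin, ?_⟩
  rw [← inner_self_eq_zero (𝕜 := ℂ), inner_sum]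
  refine sum_eq_zero fun j _ => ?_
  rw [sum_inner]
  simp_rw [← hin]
  exact hsum j

theorem diag_of_mem_face {N : ℕ} {ω : Matrix (Fin N) (Fin N) ℂ} (h : ω ∈ face N) :
    (∀ i, 0 ≤ (ω i i).re) ∧ ∑ i, (ω i i).re = 1 ∧ IsPolygon fun i => (ω i i).re := by
  obtain ⟨⟨hpos, htr⟩, -⟩ := mem_face_iff.1 h
  obtain ⟨v, hv, hv0⟩ := exists_gram_of_mem_face h
  refine ⟨fun i => (Complex.nonneg_iff.1 hpos.diag_nonneg).1, ?_, fun j => ?_⟩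
  · simpa [Matrix.trace] using congrArg Complex.re htr
  · have hsqrt : ∀ i, √((ω i i).re) = ‖v i‖ := by
      intro i
      rw [hv, inner_self_eq_norm_sq_to_K]
      norm_cast
      exact Real.sqrt_sq (norm_nonneg _)
    simp_rw [hsqrt]
    rw [← add_sum_erase _ _ (mem_univ j)] at hv0
    rw [eq_neg_of_add_eq_zero_left hv0, norm_neg]
    exact norm_sum_le _ _

theorem pureState_mem_face {N : ℕ} {ψ : EuclideanSpace ℂ (Fin N)} (hψ : ∑ i, ‖ψ i‖ ^ 2 = 1)
    (h0 : ∑ i, ψ i = 0) : pureState ψ ∈ face N := by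
  refine mem_face_iff.2 ⟨⟨Matrix.posSemidef_vecMulVec_self_star _, ?_⟩, fun j => ?_⟩
  · have : ∀ i, pureState ψ i i = ((‖ψ i‖ ^ 2 : ℝ) : ℂ) := by
      intro i
      simp [pureState, Matrix.vecMulVec_apply, Complex.mul_conj, Complex.normSq_eq_norm_sq]
    rw [Matrix.trace]
    simp only [Matrix.diag_apply, this]
    exact_mod_cast hψ
  · simp only [pureState, Matrix.vecMulVec_apply]
    rw [← sum_mul, h0, zero_mul]

theorem outputEntropy_pureState {N : ℕ} (ψ : EuclideanSpace ℂ (Fin N)) :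
    outputEntropy (pureState ψ) = ∑ i, Real.negMulLog (‖ψ i‖ ^ 2) := by
  have hψ : (pureState ψ).IsHermitian :=
    (Matrix.posSemidef_vecMulVec_self_star fun i => ψ i).isHermitian
  rw [outputEntropy_eq hψ]
  refine sum_congr rfl fun i _ => ?_
  congr 1
  simp only [pureState, Matrix.vecMulVec_apply, Pi.star_apply, RCLike.star_def, Complex.mul_conj,
    Complex.normSq_eq_norm_sq, Complex.ofReal_re]

/-! ### The states `π_jk` and `π_j` -/

theorem phiPair_apply {N : ℕ} (j k i : Fin N) :
    phiPair j k i =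
      (((√2)⁻¹ * ((if i = j then 1 else 0) - (if i = k then 1 else 0)) : ℝ) : ℂ) := by
  simp [phiPair, ket]
  split_ifs <;> simp

theorem inv_sqrt_two_mul_self : (√2)⁻¹ * (√2)⁻¹ = (1 / 2 : ℝ) := by
  rw [← mul_inv, Real.mul_self_sqrt zero_le_two, one_div]

theorem norm_phiPair_sq {N : ℕ} {j k : Fin N} (hjk : j ≠ k) (i : Fin N) :
    ‖phiPair j k i‖ ^ 2 = (if i = j then 1 / 2 else 0) + (if i = k then 1 / 2 else 0) := by
  rw [phiPair_apply, Complex.norm_real, Real.norm_eq_abs, sq_abs, mul_pow, sq (√2)⁻¹,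
    inv_sqrt_two_mul_self]
  split_ifs with h1 h2
  · exact absurd (h1.symm.trans h2) hjk
  all_goals norm_num

theorem pairState_mem_face {N : ℕ} {j k : Fin N} (hjk : j ≠ k) :
    pureState (phiPair j k) ∈ face N := by
  apply pureState_mem_face
  · simp_rw [norm_phiPair_sq hjk]
    rw [sum_add_distrib]
    norm_num
  · simp_rw [phiPair_apply]
    rw [← Complex.ofReal_sum, ← mul_sum, sum_sub_distrib]
    simp

theorem outputEntropy_pairState {N : ℕ} {j k : Fin N} (hjk : j ≠ k) :
    outputEntropy (pureState (phiPair j k)) = Real.log 2 := by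
  rw [outputEntropy_pureState]
  have : ∀ i, Real.negMulLog (‖phiPair j k i‖ ^ 2) =
      (if i = j then Real.log 2 / 2 else 0) + (if i = k then Real.log 2 / 2 else 0) := by
    intro i
    rw [norm_phiPair_sq hjk]
    split_ifs with h1 h2
    · exact absurd (h1.symm.trans h2) hjk
    all_goals simp [Real.negMulLog, Real.log_inv, inv_mul_eq_div]
  simp_rw [this]
  rw [sum_add_distrib]
  simp

theorem pureState_phiPair_apply {N : ℕ} (j k a b : Fin N) :
    pureState (phiPair j k) a b =
      ((1 / 2 * (((if a = j then 1 else 0) - (if a = k then 1 else 0)) *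
        ((if b = j then 1 else 0) - (if b = k then 1 else 0))) : ℝ) : ℂ) := by
  rw [pureState, Matrix.vecMulVec_apply, Pi.star_apply, phiPair_apply, phiPair_apply,
    RCLike.star_def, Complex.conj_ofReal, ← Complex.ofReal_mul, ← inv_sqrt_two_mul_self]
  congr 1
  ring

/-- Trace one leaves exactly two nonzero Gram vectors, and their zero sum makes them opposite, so
every inner product is determined. Mixed states are thereby excluded too. -/
theorem eq_pairState_of_diag {N : ℕ} {ω : Matrix (Fin N) (Fin N) ℂ} (h : ω ∈ face N)
    (hdiag : ∀ i, (ω i i).re = 0 ∨ (ω i i).re = 1 / 2) : ω ∈ pairStates N := by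
  obtain ⟨-, hsum, -⟩ := diag_of_mem_face h
  obtain ⟨v, hv, hv0⟩ := exists_gram_of_mem_face h
  have hnorm : ∀ i, (ω i i).re = ‖v i‖ ^ 2 := by
    intro i
    rw [hv, inner_self_eq_norm_sq_to_K]
    norm_cast
  set s := univ.filter fun i => (ω i i).re = 1 / 2 with hs
  have hcard : #s = 2 := by
    have h1 : ∀ i, (ω i i).re = if (ω i i).re = 1 / 2 then 1 / 2 else 0 := by
      intro i
      rcases hdiag i with h | h <;> simp [h]
    rw [sum_congr rfl fun i _ => h1 i, ← sum_filter, ← hs, sum_const, nsmul_eq_mul] at hsum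
    have : (#s : ℝ) = 2 := by linarith
    exact_mod_cast this
  obtain ⟨j, k, hjk, hs2⟩ := card_eq_two.1 hcard
  wlog hlt : j < k generalizing j k
  · exact this k j hjk.symm (by rw [hs2, pair_comm]) (lt_of_le_of_ne (not_lt.1 hlt) hjk.symm)
  have hzero : ∀ i, i ≠ j → i ≠ k → v i = 0 := by
    intro i hij hik
    have hi : i ∉ s := by simp [hs2, hij, hik]
    have h1 : (ω i i).re = 0 := (hdiag i).resolve_right fun h => hi (by simp [hs, h])
    rw [hnorm] at h1
    simpa using h1
  have hj : ‖v j‖ ^ 2 = 1 / 2 := by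
    have : j ∈ s := by simp [hs2]
    rw [← hnorm]
    exact (mem_filter.1 this).2
  have hself : inner ℂ (v j) (v j) = ((1 / 2 : ℝ) : ℂ) := by
    rw [inner_self_eq_norm_sq_to_K, ← hj]
    norm_cast
  have hvk : v k = -v j := by
    have h1 : ∑ i, v i = ∑ i ∈ {j, k}, v i := by
      refine (sum_subset (subset_univ _) fun i _ hi => ?_).symm
      simp only [mem_insert, mem_singleton, not_or] at hi
      exact hzero i hi.1 hi.2
    rw [sum_pair hjk, hv0] at h1
    exact eq_neg_of_add_eq_zero_right h1.symm
  have hvi : ∀ i, v i =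
      (((if i = j then 1 else 0) - (if i = k then 1 else 0) : ℝ) : ℂ) • v j := by
    intro i
    by_cases h1 : i = j
    · simp [h1, hjk]
    · by_cases h2 : i = k
      · simp [h2, hjk.symm, hvk]
      · simp [h1, h2, hzero i h1 h2]
  refine ⟨j, k, hlt, ?_⟩
  ext a b
  rw [pureState_phiPair_apply, hv, hvi a, hvi b, inner_smul_left, inner_smul_right,
    Complex.conj_ofReal, hself, ← Complex.ofReal_mul, ← Complex.ofReal_mul]
  congr 1
  ring

theorem ncard_pairStates (N : ℕ) : (pairStates N).ncard = N * (N - 1) / 2 := by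
  have himage : pairStates N = (fun x : Fin N × Fin N => pureState (phiPair x.1 x.2)) ''
      ↑((univ ×ˢ univ).filter fun x : Fin N × Fin N => x.1 < x.2) := by
    ext ω
    constructor
    · rintro ⟨j, k, h, rfl⟩
      exact ⟨(j, k), by simpa using h, rfl⟩
    · rintro ⟨⟨j, k⟩, h, rfl⟩
      exact ⟨j, k, by simpa using h, rfl⟩
  -- The nonzero diagonal entries recover the pair, hence injectivity.
  have hsupp : ∀ {j k : Fin N}, j < k → ∀ i, pureState (phiPair j k) i i ≠ 0 ↔ i = j ∨ i = k := by
    intro j k h i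
    rw [pureState_phiPair_apply]
    by_cases h1 : i = j
    · simp [h1, h.ne]
    · by_cases h2 : i = k <;> simp [h1, h2, h.ne']
  rw [himage, Set.InjOn.ncard_image, Set.ncard_coe_finset, card_product_filter_lt, card_univ,
    Fintype.card_fin, Nat.choose_two_right]
  rintro ⟨j, k⟩ h ⟨j', k'⟩ h' heq
  simp only [coe_filter, mem_product, mem_univ, and_self, true_and, Set.mem_ofPred_eq] at h h'
  have hiff : ∀ i, (i = j ∨ i = k) ↔ (i = j' ∨ i = k') := by
    intro i
    rw [← hsupp h, ← hsupp h']
    exact not_congr (by rw [show pureState (phiPair j k) = pureState (phiPair j' k') from heq])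
  have h1 := (hiff j).1 (Or.inl rfl)
  have h2 := (hiff k).1 (Or.inr rfl)
  rw [Prod.mk.injEq]
  omega

theorem amplitude_sq {N : ℕ} (hN : 2 ≤ N) : amplitude N ^ 2 = ((N : ℝ) * (N - 1))⁻¹ := by
  have : (2 : ℝ) ≤ N := by exact_mod_cast hN
  rw [amplitude, inv_pow, Real.sq_sqrt]
  exact mul_nonneg (by linarith) (by linarith)

theorem norm_phiSingle_sq {N : ℕ} (hN : 2 ≤ N) (j i : Fin N) :
    ‖phiSingle j i‖ ^ 2 = if i = j then ((N : ℝ) - 1) / N else ((N : ℝ) * (N - 1))⁻¹ := by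
  have h2 : (2 : ℝ) ≤ N := by exact_mod_cast hN
  have h1 : (N : ℝ) - 1 ≠ 0 := by linarith
  have h0 : (N : ℝ) ≠ 0 := by linarith
  simp only [phiSingle, Complex.norm_real, Real.norm_eq_abs, sq_abs]
  split_ifs
  · rw [mul_pow, amplitude_sq hN]
    field_simp
  · rw [neg_sq, amplitude_sq hN]

theorem sum_ite_eq_add_mul {N : ℕ} (j : Fin N) (a b : ℝ) :
    ∑ i, (if i = j then a else b) = a + (N - 1) * b := by
  have : ∀ i, (if i = j then a else b) = b + if i = j then a - b else 0 := by
    intro i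
    split_ifs <;> ring
  simp_rw [this, sum_add_distrib]
  simp
  ring

theorem singleState_mem_face {N : ℕ} (hN : 2 ≤ N) (j : Fin N) :
    pureState (phiSingle j) ∈ face N := by
  have h2 : (2 : ℝ) ≤ N := by exact_mod_cast hN
  have h1 : (N : ℝ) - 1 ≠ 0 := by linarith
  have h0 : (N : ℝ) ≠ 0 := by linarith
  apply pureState_mem_face
  · simp_rw [norm_phiSingle_sq hN]
    rw [sum_ite_eq_add_mul]
    field_simp
    ring
  · simp only [phiSingle]
    rw [← Complex.ofReal_sum, sum_ite_eq_add_mul]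
    simp

theorem outputEntropy_singleState {N : ℕ} (hN : 2 ≤ N) (j : Fin N) :
    outputEntropy (pureState (phiSingle j)) = singleEntropy N := by
  have h2 : (2 : ℝ) ≤ N := by exact_mod_cast hN
  have h1 : (N : ℝ) - 1 ≠ 0 := by linarith
  have h0 : (N : ℝ) ≠ 0 := by linarith
  rw [outputEntropy_pureState]
  simp_rw [norm_phiSingle_sq hN, apply_ite Real.negMulLog]
  rw [sum_ite_eq_add_mul, Real.negMulLog, Real.negMulLog, Real.log_inv, Real.log_mul h0 h1,
    Real.log_div h1 h0, singleEntropy]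
  field_simp
  ring

/-- Two of these states could share a diagonal only if `(N - 1)² = 1`; at `N = 2` they do coincide,
hence `3 ≤ N`. -/
theorem ncard_singleStates {N : ℕ} (hN : 3 ≤ N) : (singleStates N).ncard = N := by
  have h3 : (3 : ℝ) ≤ N := by exact_mod_cast hN
  have hrange : singleStates N = (fun j : Fin N => pureState (phiSingle j)) '' Set.univ := by
    ext ω
    simp [singleStates, eq_comm]
  rw [hrange, Set.ncard_image_of_injective, Set.ncard_univ, Nat.card_fin]
  intro j k h
  by_contra hjk
  have hdiag : ∀ l, pureState (phiSingle l) j j = ((‖phiSingle l j‖ ^ 2 : ℝ) : ℂ) := by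
    intro l
    simp [pureState, Matrix.vecMulVec_apply, Complex.mul_conj, Complex.normSq_eq_norm_sq]
  have he := congrFun (congrFun (show pureState (phiSingle j) = pureState (phiSingle k) from h) j) j
  rw [hdiag, hdiag, norm_phiSingle_sq (by omega), norm_phiSingle_sq (by omega), if_pos rfl,
    if_neg hjk, Complex.ofReal_inj] at he
  have h1 : (N : ℝ) - 1 ≠ 0 := by linarith
  have h0 : (N : ℝ) ≠ 0 := by linarith
  field_simp at he
  nlinarith

/-! ### Minima and minimisers on the face -/

theorem log_two_le_outputEntropy {N : ℕ} (hN : N ≤ 6) {ω : Matrix (Fin N) (Fin N) ℂ}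
    (h : ω ∈ face N) :
    Real.log 2 ≤ outputEntropy ω ∧ (outputEntropy ω = Real.log 2 → ω ∈ pairStates N) := by
  obtain ⟨hp, hsum, hpoly⟩ := diag_of_mem_face h
  have hle := log_two_le_entropy_of_isPolygon hp hsum hpoly (by simpa using hN)
  rw [outputEntropy_eq h.1.1.isHermitian]
  exact ⟨hle.1, fun he => eq_pairState_of_diag h (hle.2 he)⟩

theorem singleEntropy_le_outputEntropy {N : ℕ} (hN : 7 ≤ N) {ω : Matrix (Fin N) (Fin N) ℂ}
    (h : ω ∈ face N) : singleEntropy N ≤ outputEntropy ω := by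
  obtain ⟨hp, hsum, hpoly⟩ := diag_of_mem_face h
  have hle := singleEntropy_le_entropy_of_isPolygon hp hsum hpoly (by simpa using hN)
  rw [Fintype.card_fin] at hle
  rwa [outputEntropy_eq h.1.1.isHermitian]

theorem isLeast_log_two {N : ℕ} (h2 : 2 ≤ N) (h6 : N ≤ 6) :
    IsLeast (outputEntropy '' face N) (Real.log 2) := by
  have hne : (⟨0, by omega⟩ : Fin N) ≠ ⟨1, by omega⟩ := by simp
  refine ⟨⟨_, pairState_mem_face hne, outputEntropy_pairState hne⟩, ?_⟩
  rintro _ ⟨ω, hω, rfl⟩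
  exact (log_two_le_outputEntropy h6 hω).1

theorem isLeast_singleEntropy {N : ℕ} (hN : 7 ≤ N) :
    IsLeast (outputEntropy '' face N) (singleEntropy N) := by
  refine ⟨⟨_, singleState_mem_face (by omega) ⟨0, by omega⟩,
    outputEntropy_singleState (by omega) _⟩, ?_⟩
  rintro _ ⟨ω, hω, rfl⟩
  exact singleEntropy_le_outputEntropy hN hω

theorem minimizers_eq_pairStates {N : ℕ} (h2 : 2 ≤ N) (h6 : N ≤ 6) :
    minimizers N = pairStates N := by
  ext ω
  constructor
  · rintro ⟨hω, hmin⟩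
    obtain ⟨ω', hω', h'⟩ := (isLeast_log_two h2 h6).1
    have hle : outputEntropy ω ≤ Real.log 2 := h' ▸ hmin hω'
    have h := log_two_le_outputEntropy h6 hω
    exact h.2 (le_antisymm hle h.1)
  · rintro ⟨j, k, hjk, rfl⟩
    refine ⟨pairState_mem_face hjk.ne, fun ω' hω' => ?_⟩
    rw [Set.mem_ofPred_eq, outputEntropy_pairState hjk.ne]
    exact (log_two_le_outputEntropy h6 hω').1

theorem singleStates_subset_minimizers {N : ℕ} (hN : 7 ≤ N) :
    singleStates N ⊆ minimizers N := by
  rintro _ ⟨j, rfl⟩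
  refine ⟨singleState_mem_face (by omega) j, fun ω' hω' => ?_⟩
  rw [Set.mem_ofPred_eq, outputEntropy_singleState (by omega)]
  exact singleEntropy_le_outputEntropy hN hω'

theorem minOutputEntropy_eq_log_two {N : ℕ} (h2 : 2 ≤ N) (h6 : N ≤ 6) :
    minOutputEntropy N = Real.log 2 :=
  (isLeast_log_two h2 h6).csInf_eq

theorem minOutputEntropy_eq_singleEntropy {N : ℕ} (hN : 7 ≤ N) :
    minOutputEntropy N = singleEntropy N :=
  (isLeast_singleEntropy hN).csInf_eq

end DiagonalMap

theorem theorem1 :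
    (∀ N : ℕ, 2 ≤ N → N ≤ 6 →
      IsLeast (DiagonalMap.outputEntropy '' DiagonalMap.face N)
        (DiagonalMap.minOutputEntropy N) ∧
      DiagonalMap.minOutputEntropy N = Real.log 2 ∧
      DiagonalMap.minimizers N = DiagonalMap.pairStates N ∧
      (DiagonalMap.pairStates N).ncard = N * (N - 1) / 2) ∧
    (∀ N : ℕ, 6 < N →
      IsLeast (DiagonalMap.outputEntropy '' DiagonalMap.face N)
        (DiagonalMap.minOutputEntropy N) ∧
      DiagonalMap.minOutputEntropy N =
        Real.log (N : ℝ) - (1 - 2 / (N : ℝ)) * Real.log ((N : ℝ) - 1) ∧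
      DiagonalMap.singleStates N ⊆ DiagonalMap.minimizers N ∧
      (DiagonalMap.singleStates N).ncard = N) ∧
    Filter.Tendsto DiagonalMap.minOutputEntropy Filter.atTop (nhds 0) := by
  refine ⟨fun N h2 h6 => ?_, fun N hN => ?_, ?_⟩
  · rw [DiagonalMap.minOutputEntropy_eq_log_two h2 h6]
    exact ⟨DiagonalMap.isLeast_log_two h2 h6, rfl, DiagonalMap.minimizers_eq_pairStates h2 h6,
      DiagonalMap.ncard_pairStates N⟩
  · rw [DiagonalMap.minOutputEntropy_eq_singleEntropy hN]
    exact ⟨DiagonalMap.isLeast_singleEntropy hN, rfl,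
      DiagonalMap.singleStates_subset_minimizers hN, DiagonalMap.ncard_singleStates (by omega)⟩
  · refine tendsto_singleEntropy.congr' ?_
    filter_upwards [Filter.eventually_ge_atTop 7] with N hN
    exact (DiagonalMap.minOutputEntropy_eq_singleEntropy hN).symm
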